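/- Let $\mathbb{CP}^2$ be the complex projective plane with homogeneous coordinates $[Z_1:Z_2:Z_3]$ and the affine charts $$U_1=\{Z_3\neq0\}:\ (z_1,z_2)=\Big(\tfrac{Z_1}{Z_3},\tfrac{Z_2}{Z_3}\Big),\qquad U_2=\{Z_1\neq0\}:\ (\zeta_1,\zeta_2)=\Big(\tfrac{Z_2}{Z_1},\tfrac{Z_3}{Z_1}\Big),\qquad U_3=\{Z_2\neq0\}:\ (\xi_1,\xi_2)=\Big(\tfrac{Z_1}{Z_2},\tfrac{Z_3}{Z_2}\Big).$$ There is a holomorphic vector field on all of $\mathbb{CP}^2$ that is given in these charts by $$U_1:\ (z_1^2+z_2)\,\partial_{z_1}+z_1z_2\,\partial_{z_2},\qquad U_2:\ -\zeta_1^2\,\partial_{\zeta_1}-(1+\zeta_1\zeta_2)\,\partial_{\zeta_2},\qquad U_3:\ \partial_{\xi_1}-\xi_1\,\partial_{\xi_2},$$ and its only zero is the origin $[0:0:1]$ of $U_1$. Let $w$ be the corresponding real vector field on the underlying real $4$-manifold (its components are the real and imaginary parts of the complex components). It is smooth, and in the real coordinates $z_1=x+iy,\ z_2=z+it$; $\zeta_1=a+ib,\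 \zeta_2=c+id$; $\xi_1=\alpha+i\beta,\ \xi_2=\gamma+i\delta$ it is given by $$\begin{aligned} U_1:\ & (x^2-y^2+z)\,\partial_x+(2xy+t)\,\partial_y+(xz-ty)\,\partial_z+(tx+yz)\,\partial_t,\\ U_2:\ & -(a^2-b^2)\,\partial_a-2ab\,\partial_b-(ac-bd+1)\,\partial_c-(ad+bc)\,\partial_d,\\ U_3:\ & \partial_\alpha-\alpha\,\partial_\gamma-\beta\,\partial_\delta . \end{aligned}$$ The only zero of $w$ is the origin of $U_1$; it is isolated and has index $+3$. Here the index of an isolated zero is the local mapping degree, at that point, of the vector field read in a chart (equivalently, the degree of $w/\lVert w\rVert$ from a small sphere around the zero to the unit sphere): the number of preimages in a small ball of any regular value sufficiently close to $0$, counted with the signs of the Jacobian determinants. -/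

import Mathlib

open scoped Manifold ContDiff Topology

noncomputable section

/-- The complex projective plane: nonzero triples `(Z 0, Z 1, Z 2)` (in the usual notation
`(Z₁, Z₂, Z₃)`) modulo nonzero complex scalars. -/
def CP2 : Type := Projectivization ℂ (Fin 3 → ℂ)

namespace CP2

/-- The quotient topology. -/
instance : TopologicalSpace CP2 :=
  inferInstanceAs (TopologicalSpace (Quotient (projectivizationSetoid ℂ (Fin 3 → ℂ))))

/-- The point with homogeneous coordinates `v`. -/
def mk (v : Fin 3 → ℂ) (hv : v ≠ 0) : CP2 := Projectivization.mk ℂ v hv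

theorem mk_surj (p : CP2) : ∃ v hv, p = mk v hv := by
  induction p using Projectivization.ind with
  | h v hv => exact ⟨v, hv, rfl⟩

theorem mk_eq_of_smul {v w : Fin 3 → ℂ} (hv : v ≠ 0) (hw : w ≠ 0) (c : ℂ) (h : c • w = v) :
    mk v hv = mk w hw :=
  (Projectivization.mk_eq_mk_iff' ℂ v w hv hw).2 ⟨c, h⟩

theorem isQuotientMap_mk : Topology.IsQuotientMap
    (fun v : {v : Fin 3 → ℂ // v ≠ 0} => mk v.1 v.2) :=
  isQuotientMap_quot_mk

/-- The ratio `Z i / Z k` of homogeneous coordinates (with value `0` where `Z k = 0`). -/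
def ratio (i k : Fin 3) : CP2 → ℂ :=
  Projectivization.lift (fun v => v.1 i / v.1 k) (by
    rintro ⟨a, ha⟩ ⟨b, hb⟩ t h
    have h' : a = t • b := h
    have ht : t ≠ 0 := by rintro rfl; simp at h'; exact ha h'
    simp [h', mul_div_mul_left _ _ ht])

@[simp] theorem ratio_mk (i k : Fin 3) (v : Fin 3 → ℂ) (hv : v ≠ 0) :
    ratio i k (mk v hv) = v i / v k := rfl

/-- The points with `Z k ≠ 0`. -/
def affineOpen (k : Fin 3) : Set CP2 := {p | ratio k k p ≠ 0}

@[simp] theorem mk_mem_affineOpen (k : Fin 3) (v : Fin 3 → ℂ) (hv : v ≠ 0) :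
    mk v hv ∈ affineOpen k ↔ v k ≠ 0 := by
  simp [affineOpen]

theorem isOpen_affineOpen (k : Fin 3) : IsOpen (affineOpen k) := by
  rw [← isQuotientMap_mk.isOpen_preimage]
  have : (fun v : {v : Fin 3 → ℂ // v ≠ 0} => mk v.1 v.2) ⁻¹' affineOpen k
      = {v | v.1 k ≠ 0} := by
    ext v; simp
  rw [this]
  exact isOpen_ne_fun ((continuous_apply k).comp continuous_subtype_val) continuous_const

theorem continuousOn_ratio (i k : Fin 3) : ContinuousOn (ratio i k) (affineOpen k) := by
  rw [isQuotientMap_mk.continuousOn_isOpen_iff (isOpen_affineOpen k)]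
  have : (ratio i k ∘ fun v : {v : Fin 3 → ℂ // v ≠ 0} => mk v.1 v.2)
      = fun v => v.1 i / v.1 k := rfl
  rw [this]
  refine ContinuousOn.div ((continuous_apply i).comp continuous_subtype_val).continuousOn
    ((continuous_apply k).comp continuous_subtype_val).continuousOn ?_
  intro v hv
  simpa using hv

/-- The triple with entry `1` in place `k`, `z.1` in place `i` and `z.2` in the remaining place. -/
def homog (i k : Fin 3) (z : ℂ × ℂ) : Fin 3 → ℂ :=
  fun l => if l = k then 1 else if l = i then z.1 else z.2

theorem homog_ne_zero (i k : Fin 3) (z : ℂ × ℂ) : homog i k z ≠ 0 := by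
  intro h
  have := congrFun h k
  simp [homog] at this

/-- For distinct `i, j, k`: the affine chart `(Z i / Z k, Z j / Z k)` on `Z k ≠ 0`,
a bijection onto `ℂ²`. -/
def affineChart (i j k : Fin 3) (h : i ≠ j ∧ j ≠ k ∧ i ≠ k) :
    OpenPartialHomeomorph CP2 (ℂ × ℂ) where
  toFun p := (ratio i k p, ratio j k p)
  invFun z := mk (homog i k z) (homog_ne_zero i k z)
  source := affineOpen k
  target := Set.univ
  map_source' _ _ := Set.mem_univ _
  map_target' z _ := by simp [homog]
  left_inv' p hp := by
    obtain ⟨v, hv, rfl⟩ := mk_surj p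
    rw [mk_mem_affineOpen] at hp
    refine mk_eq_of_smul _ _ (v k)⁻¹ ?_
    funext l
    have hl : l = k ∨ l = i ∨ l = j := by omega
    have hik := h.2.2
    have hjk := h.2.1
    have hij := h.1
    rcases hl with rfl | rfl | rfl
    · simp [homog, hp]
    · simp [homog, hik, div_eq_inv_mul]
    · simp [homog, hjk, hij.symm, div_eq_inv_mul]
  right_inv' z _ := by
    simp [homog, h.2.2, h.2.1, h.1.symm]
  open_source := isOpen_affineOpen k
  open_target := isOpen_univ
  continuousOn_toFun := (continuousOn_ratio i k).prodMk (continuousOn_ratio j k)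
  continuousOn_invFun := by
    refine Continuous.continuousOn ?_
    refine isQuotientMap_mk.continuous.comp
      (g := fun v : {v : Fin 3 → ℂ // v ≠ 0} => mk v.1 v.2)
      (f := fun z => ⟨homog i k z, homog_ne_zero i k z⟩) ?_
    refine Continuous.subtype_mk (continuous_pi fun l => ?_) _
    unfold homog
    split_ifs <;> fun_prop

/-- `U₁`: `(z₁, z₂) = (Z₁ / Z₃, Z₂ / Z₃)`. -/
def chart1 : OpenPartialHomeomorph CP2 (ℂ × ℂ) := affineChart 0 1 2 (by decide)

/-- `U₂`: `(ζ₁, ζ₂) = (Z₂ / Z₁, Z₃ / Z₁)`. -/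
def chart2 : OpenPartialHomeomorph CP2 (ℂ × ℂ) := affineChart 1 2 0 (by decide)

/-- `U₃`: `(ξ₁, ξ₂) = (Z₁ / Z₂, Z₃ / Z₂)`. -/
def chart3 : OpenPartialHomeomorph CP2 (ℂ × ℂ) := affineChart 0 2 1 (by decide)

theorem exists_mem_affineOpen (p : CP2) :
    p ∈ affineOpen 2 ∨ p ∈ affineOpen 0 ∨ p ∈ affineOpen 1 := by
  obtain ⟨v, hv, rfl⟩ := mk_surj p
  simp only [mk_mem_affineOpen]
  by_contra! h
  apply hv
  funext l
  fin_cases l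
  · exact h.2.1
  · exact h.2.2
  · exact h.1

open Classical in
/-- The atlas of the three affine charts; the preferred chart at a point is the first one of
`chart1`, `chart2`, `chart3` whose domain contains it. -/
instance : ChartedSpace (ℂ × ℂ) CP2 where
  atlas := {chart1, chart2, chart3}
  chartAt p := if p ∈ affineOpen 2 then chart1 else if p ∈ affineOpen 0 then chart2 else chart3
  mem_chart_source p := by
    rcases exists_mem_affineOpen p with h | h | h <;> split_ifs <;> assumption
  chart_mem_atlas p := by split_ifs <;> simp

theorem contDiffOn_transition (𝕜 : Type*) [NontriviallyNormedField 𝕜] [NormedAlgebra 𝕜 ℂ]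
    (n : ℕ∞ω)
    (i j k : Fin 3) (h : i ≠ j ∧ j ≠ k ∧ i ≠ k) (i' j' k' : Fin 3)
    (h' : i' ≠ j' ∧ j' ≠ k' ∧ i' ≠ k') :
    ContDiffOn 𝕜 n ((affineChart i j k h).symm ≫ₕ affineChart i' j' k' h')
      ((affineChart i j k h).symm ≫ₕ affineChart i' j' k' h').source := by
  have hom (l : Fin 3) : ContDiff 𝕜 n (fun z => homog i k z l) := by
    unfold homog
    split_ifs <;> fun_prop
  have hs : ∀ z ∈ ((affineChart i j k h).symm ≫ₕ affineChart i' j' k' h').source,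
      homog i k z k' ≠ 0 := by
    intro z hz
    rw [OpenPartialHomeomorph.trans_source] at hz
    exact (mk_mem_affineOpen k' _ (homog_ne_zero i k z)).1 hz.2
  have hdiv (l : Fin 3) : ContDiffOn 𝕜 n (fun z => homog i k z l / homog i k z k')
      ((affineChart i j k h).symm ≫ₕ affineChart i' j' k' h').source := by
    simp only [div_eq_mul_inv]
    exact (hom l).contDiffOn.mul ((hom k').contDiffOn.inv hs)
  exact (hdiv i').prodMk (hdiv j')

theorem isManifold_aux (𝕜 : Type*) [NontriviallyNormedField 𝕜] [NormedAlgebra 𝕜 ℂ] (n : ℕ∞ω) :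
    IsManifold 𝓘(𝕜, ℂ × ℂ) n CP2 := by
  refine isManifold_of_contDiffOn _ _ _ ?_
  intro e e' he he'
  have hform : ∀ f ∈ atlas (ℂ × ℂ) CP2, ∃ i j k h, f = affineChart i j k h := by
    rintro f (rfl | rfl | rfl) <;> exact ⟨_, _, _, _, rfl⟩
  obtain ⟨i, j, k, h, rfl⟩ := hform e he
  obtain ⟨i', j', k', h', rfl⟩ := hform e' he'
  simpa using contDiffOn_transition 𝕜 n i j k h i' j' k' h'

/-- `CP2` as a two-dimensional complex manifold. -/
instance instIsManifoldComplex (n : ℕ∞ω) : IsManifold 𝓘(ℂ, ℂ × ℂ) n CP2 := isManifold_aux ℂ n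

/-- `CP2` as a four-dimensional real manifold. -/
instance instIsManifoldReal (n : ℕ∞ω) : IsManifold 𝓘(ℝ, ℂ × ℂ) n CP2 := isManifold_aux ℝ n

/-- The origin `[0 : 0 : 1]` of the chart `U₁`. -/
def origin1 : CP2 := chart1.symm (0, 0)

/-- In the (real or complex) coordinates `φ` on `U`, the vector field `V` has components `f`:
the differential of `φ` at `p` maps `V p` to `f (φ p)`. -/
def HasComponents (𝕜 : Type*) [NontriviallyNormedField 𝕜] [NormedAlgebra 𝕜 ℂ]
    {F : Type*} [NormedAddCommGroup F] [NormedSpace 𝕜 F]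
    (U : Set CP2) (φ : CP2 → F) (V : (p : CP2) → TangentSpace 𝓘(𝕜, ℂ × ℂ) p) (f : F → F) : Prop :=
  ∀ p ∈ U, (mfderiv 𝓘(𝕜, ℂ × ℂ) 𝓘(𝕜, F) φ p (V p) : F) = f (φ p)

/-- The real vector field on the underlying real manifold given by a complex one (its "real part"):
the same tangent vectors, whose real components in the real coordinates are the real and imaginary
parts of the complex components. -/
def realPart (V : (p : CP2) → TangentSpace 𝓘(ℂ, ℂ × ℂ) p) :
    (p : CP2) → TangentSpace 𝓘(ℝ, ℂ × ℂ) p :=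
  fun p => (V p : ℂ × ℂ)

/-- The real coordinates `(Re u₁, Im u₁, Re u₂, Im u₂)` belonging to complex coordinates. -/
def realCoords (e : OpenPartialHomeomorph CP2 (ℂ × ℂ)) (p : CP2) : EuclideanSpace ℝ (Fin 4) :=
  !₂[(e p).1.re, (e p).1.im, (e p).2.re, (e p).2.im]

end CP2

/-- `f` has an isolated zero at `x` (and is `C¹` near `x`), and its local (Brouwer) degree there
is `k`: on every small ball around `x`, every regular value `y` close to `0` has finitely many
preimages, and these, counted with the signs of the Jacobian determinants, add up to `k`.
(This is also the degree of `f / ‖f‖` from a small sphere around `x` to the unit sphere.) -/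
structure HasLocalDegreeAt {E : Type*} [NormedAddCommGroup E] [NormedSpace ℝ E]
    [FiniteDimensional ℝ E] (f : E → E) (x : E) (k : ℤ) : Prop where
  contDiffAt : ContDiffAt ℝ 1 f x
  map_eq_zero : f x = 0
  isolated : ∀ᶠ u in 𝓝[≠] x, f u ≠ 0
  count : ∀ᶠ r in 𝓝[>] (0 : ℝ), ∀ᶠ y in 𝓝 (0 : E),
    (∀ u ∈ Metric.ball x r, f u = y → (fderiv ℝ f u).det ≠ 0) →
      {u ∈ Metric.ball x r | f u = y}.Finite ∧
      ∑ᶠ u ∈ {u ∈ Metric.ball x r | f u = y}, (SignType.sign (fderiv ℝ f u).det : ℤ) = k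

/-- The vector field `V` on a real manifold has an isolated zero of index `k` at `p`: the local
degree of `V`, read in the preferred chart at `p`, is `k`. -/
def HasIndexAt {E : Type*} [NormedAddCommGroup E] [NormedSpace ℝ E] [FiniteDimensional ℝ E]
    {M : Type*} [TopologicalSpace M] [ChartedSpace E M]
    (V : (q : M) → TangentSpace 𝓘(ℝ, E) q) (p : M) (k : ℤ) : Prop :=
  HasLocalDegreeAt
    (fun u : E => (mfderiv 𝓘(ℝ, E) 𝓘(ℝ, E) (chartAt E p) ((chartAt E p).symm u)
      (V ((chartAt E p).symm u)) : E))
    (chartAt E p p) k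

end

/-! The field is the projection to the plane of the linear field `linearField` on `ℂ³`. This field
commutes with scaling, so it descends: on the representative with `k`-th entry 1, subtracting the
radial multiple that keeps this entry fixed gives the components `chartField`, and the quotient rule
shows that these agree across charts (`exists_hasFDerivAt_transition`). Zeros are eigenlines of the
linear map, which is a single nilpotent Jordan block and so has only one, `[0 : 0 : 1]`; the proof
checks this from the chart formulas.

For the index, solving `(z₁² + z₂, z₁z₂) = y` for `z₂` leaves the cubic `z₁³ - y₁z₁ + y₂ = 0`. Its
roots are small when `y` is, and simple when `y` is regular, so there are exactly three preimages.
Each counts `+1`, since the real Jacobian of a holomorphic map is the squared modulus of its complex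
Jacobian (`det_restrictScalars_eq_normSq`). -/

open Polynomial in
/-- A cubic all of whose roots are simple has exactly three roots. -/
theorem exists_finset_roots_cubic (p q : ℂ)
    (h : ∀ z : ℂ, z ^ 3 - p * z + q = 0 → 3 * z ^ 2 - p ≠ 0) :
    ∃ s : Finset ℂ, s.card = 3 ∧ ∀ z, z ∈ s ↔ z ^ 3 - p * z + q = 0 := by
  set P : ℂ[X] := X ^ 3 - C p * X + C q with hP
  have hdeg : P.natDegree = 3 := by rw [hP]; compute_degree!
  have hP0 : P ≠ 0 := by
    intro h0
    rw [h0] at hdeg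
    simp at hdeg
  have hroot (z : ℂ) : P.IsRoot z ↔ z ^ 3 - p * z + q = 0 := by simp [hP, IsRoot]
  -- A repeated root would be a common root of `P` and its derivative, which `h` forbids.
  have hnodup : P.roots.Nodup := by
    rw [Multiset.nodup_iff_count_le_one]
    intro z
    rw [count_roots]
    by_contra! hlt
    obtain ⟨h1, h2⟩ := (one_lt_rootMultiplicity_iff_isRoot hP0).1 hlt
    refine h z ((hroot z).1 h1) ?_
    have h3 : P.derivative.eval z = 3 * z ^ 2 - p := by simp [hP]; norm_num
    exact h3.symm.trans h2
  refine ⟨P.roots.toFinset, ?_, fun z => ?_⟩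
  · rw [Multiset.toFinset_card_of_nodup hnodup,
      ← (IsAlgClosed.splits P).natDegree_eq_card_roots, hdeg]
  · rw [Multiset.mem_toFinset, mem_roots hP0, hroot]

/-- The roots of `z ^ 3 - p z + q` are small when the coefficients are. -/
theorem norm_lt_of_cubic_eq_zero {p q z : ℂ} {δ : ℝ} (hδ : 0 < δ) (hp : ‖p‖ < δ ^ 2 / 2)
    (hq : ‖q‖ < δ ^ 3 / 2) (h : z ^ 3 - p * z + q = 0) : ‖z‖ < δ := by
  by_contra! hz
  have h1 : ‖z‖ ^ 3 ≤ ‖p‖ * ‖z‖ + ‖q‖ := by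
    have : z ^ 3 = p * z - q := by linear_combination h
    rw [← norm_pow, this, ← norm_mul]
    exact norm_sub_le _ _
  have h2 : δ ^ 2 ≤ ‖z‖ ^ 2 := by gcongr
  have h3 : δ ^ 3 ≤ ‖z‖ ^ 3 := by gcongr
  -- Each of the two lower-order terms is at most half of `‖z‖ ^ 3`, the constant one strictly less,
  -- so they cannot balance the leading term.
  have h4 : ‖p‖ * ‖z‖ ≤ ‖z‖ ^ 2 / 2 * ‖z‖ := by gcongr; linarith
  nlinarith

/-- The real determinant of a complex linear endomorphism. -/
theorem det_restrictScalars_eq_normSq {E : Type*} [NormedAddCommGroup E] [NormedSpace ℂ E]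
    [NormedSpace ℝ E] [IsScalarTower ℝ ℂ E] [FiniteDimensional ℂ E] (L : E →L[ℂ] E) :
    (L.restrictScalars ℝ).det = Complex.normSq L.det := by
  have h := LinearMap.det_restrictScalars (R := ℝ) (S := ℂ) (f := (L : E →ₗ[ℂ] E))
  rw [Algebra.norm_complex_eq] at h
  exact h

/-! ### The vector field induced by a linear field on `ℂ³` -/

namespace CP2

/-- The linear vector field `Z₂ ∂/∂Z₁ - Z₁ ∂/∂Z₃` on `ℂ³`. -/
def linearField (v : Fin 3 → ℂ) : Fin 3 → ℂ := ![v 1, 0, -v 0]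

theorem linearField_smul (c : ℂ) (v : Fin 3 → ℂ) (l : Fin 3) :
    linearField (c • v) l = c * linearField v l := by
  fin_cases l <;> simp [linearField]

/-- The components, in the chart `(Z i / Z k, Z j / Z k)`, of the vector field on `CP2` induced
by `linearField`. -/
def chartField (i j k : Fin 3) (z : ℂ × ℂ) : ℂ × ℂ :=
  (linearField (homog i k z) i - z.1 * linearField (homog i k z) k,
    linearField (homog i k z) j - z.2 * linearField (homog i k z) k)

/-- The derivative of `homog i k`. -/
noncomputable def homogDeriv (i k l : Fin 3) : ℂ × ℂ →L[ℂ] ℂ :=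
  if l = k then 0 else if l = i then ContinuousLinearMap.fst ℂ ℂ ℂ
    else ContinuousLinearMap.snd ℂ ℂ ℂ

theorem hasFDerivAt_homog (i k l : Fin 3) (z : ℂ × ℂ) :
    HasFDerivAt (fun z => homog i k z l) (homogDeriv i k l) z := by
  unfold homog homogDeriv
  split_ifs
  · exact hasFDerivAt_const _ _
  · exact hasFDerivAt_fst
  · exact hasFDerivAt_snd

/-- The lift of the chart field to the slice where entry `k` is 1 differs from the linear field only
by a radial vector. -/
theorem homogDeriv_chartField {i j k : Fin 3} (h : i ≠ j ∧ j ≠ k ∧ i ≠ k) (l : Fin 3)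
    (z : ℂ × ℂ) : homogDeriv i k l (chartField i j k z)
      = linearField (homog i k z) l - homog i k z l * linearField (homog i k z) k := by
  obtain ⟨hij, hjk, hik⟩ := h
  have hl : l = k ∨ l = i ∨ l = j := by omega
  rcases hl with rfl | rfl | rfl
  · simp [homogDeriv, homog]
  · simp [homogDeriv, chartField, homog, hik]
  · simp [homogDeriv, chartField, homog, hjk, hij.symm]

theorem homog_transition {i k i' j' k' : Fin 3} (h' : i' ≠ j' ∧ j' ≠ k' ∧ i' ≠ k')
    {z : ℂ × ℂ} (hz : homog i k z k' ≠ 0) :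
    homog i' k' (homog i k z i' / homog i k z k', homog i k z j' / homog i k z k')
      = (homog i k z k')⁻¹ • homog i k z := by
  obtain ⟨hij, hjk, hik⟩ := h'
  funext l
  have hl : l = k' ∨ l = i' ∨ l = j' := by omega
  rcases hl with rfl | rfl | rfl
  · rw [homog, if_pos rfl, Pi.smul_apply, smul_eq_mul, inv_mul_cancel₀ hz]
  · simp only [Pi.smul_apply, smul_eq_mul, ← div_eq_inv_mul]
    simp [homog.eq_def l k', hik]
  · simp only [Pi.smul_apply, smul_eq_mul, ← div_eq_inv_mul]
    simp [homog.eq_def i' k', hjk, hij.symm]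

/-- Ratios of homogeneous coordinates are constant in the radial direction, so the radial correction
of the first chart drops out of the quotient rule. By homogeneity, what remains is the field of the
second chart. -/
theorem exists_hasFDerivAt_transition {i j k i' j' k' : Fin 3} (h : i ≠ j ∧ j ≠ k ∧ i ≠ k)
    (h' : i' ≠ j' ∧ j' ≠ k' ∧ i' ≠ k') {z : ℂ × ℂ} (hz : homog i k z k' ≠ 0) :
    ∃ L : ℂ × ℂ →L[ℂ] ℂ × ℂ,
      HasFDerivAt (fun z => affineChart i' j' k' h' ((affineChart i j k h).symm z)) L z ∧
      L (chartField i j k z) =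
        chartField i' j' k' (affineChart i' j' k' h' ((affineChart i j k h).symm z)) := by
  have hinv := (hasDerivAt_inv hz).comp_hasFDerivAt z (hasFDerivAt_homog i k k' z)
  have hd (l : Fin 3) := (hasFDerivAt_homog i k l z).mul hinv
  have heq : (fun z => affineChart i' j' k' h' ((affineChart i j k h).symm z)) =
      fun z => (homog i k z i' / homog i k z k', homog i k z j' / homog i k z k') := rfl
  refine ⟨_, ((hd i').prodMk (hd j')).congr_of_eventuallyEq (.of_eq ?_), ?_⟩
  · rw [heq]
    funext z
    simp [div_eq_mul_inv]
  · change _ = chartField i' j' k'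
      (homog i k z i' / homog i k z k', homog i k z j' / homog i k z k')
    rw [chartField.eq_def i' j' k', homog_transition h' hz]
    simp only [linearField_smul, ContinuousLinearMap.prod_apply, add_apply,
      smul_apply, homogDeriv_chartField h, smul_eq_mul, Function.comp_apply]
    ext
    · field_simp
      ring
    · field_simp
      ring

theorem chartAt_eq (p : CP2) : ∃ i j k, ∃ h : i ≠ j ∧ j ≠ k ∧ i ≠ k,
    chartAt (ℂ × ℂ) p = affineChart i j k h := by
  have : chartAt (ℂ × ℂ) p ∈ atlas (ℂ × ℂ) CP2 := chart_mem_atlas _ p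
  rcases this with h | h | h <;> exact ⟨_, _, _, _, h⟩

open Classical in
/-- The vector field on `CP2` induced by `linearField`. -/
noncomputable def field (p : CP2) : TangentSpace 𝓘(ℂ, ℂ × ℂ) p :=
  if p ∈ affineOpen 2 then chartField 0 1 2 (chart1 p)
  else if p ∈ affineOpen 0 then chartField 1 2 0 (chart2 p) else chartField 0 2 1 (chart3 p)

/-- A tangent vector at `p` is stored as its coordinates in the preferred chart, so the cases of
`field` have to match those of `chartAt`. -/
theorem chartAt_eq_and_field (p : CP2) : ∃ i j k, ∃ h : i ≠ j ∧ j ≠ k ∧ i ≠ k,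
    chartAt (ℂ × ℂ) p = affineChart i j k h ∧
      (field p : ℂ × ℂ) = chartField i j k (affineChart i j k h p) := by
  by_cases h2 : p ∈ affineOpen 2
  · exact ⟨0, 1, 2, by decide, if_pos h2, if_pos h2⟩
  by_cases h0 : p ∈ affineOpen 0
  · exact ⟨1, 2, 0, by decide, (if_neg h2).trans (if_pos h0), (if_neg h2).trans (if_pos h0)⟩
  · exact ⟨0, 2, 1, by decide, (if_neg h2).trans (if_neg h0), (if_neg h2).trans (if_neg h0)⟩

/-- In every affine chart `e`, read through the preferred chart at `p`, the derivative of `e` at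
`p` maps `field p` to the components given by `chartField`. -/
theorem exists_hasFDerivAt_chart {i j k : Fin 3} (h : i ≠ j ∧ j ≠ k ∧ i ≠ k) {p : CP2}
    (hp : p ∈ affineOpen k) :
    ∃ L : ℂ × ℂ →L[ℂ] ℂ × ℂ,
      HasFDerivAt (fun z => affineChart i j k h ((chartAt (ℂ × ℂ) p).symm z)) L
        (chartAt (ℂ × ℂ) p p) ∧
      L (field p) = chartField i j k (affineChart i j k h p) := by
  obtain ⟨i', j', k', h', hc, hf⟩ := chartAt_eq_and_field p
  have hps : p ∈ (affineChart i' j' k' h').source := hc ▸ mem_chart_source (ℂ × ℂ) p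
  have hinv := (affineChart i' j' k' h').left_inv hps
  have hz : homog i' k' (affineChart i' j' k' h' p) k ≠ 0 := by
    rw [← mk_mem_affineOpen k _ (homog_ne_zero i' k' _)]
    change (affineChart i' j' k' h').symm _ ∈ _
    rwa [hinv]
  obtain ⟨L, hL, hLf⟩ := exists_hasFDerivAt_transition h' h hz
  rw [hinv] at hLf
  rw [hc]
  exact ⟨L, hL, (congrArg L hf).trans hLf⟩

/-! ### Components and smoothness, over `ℝ` and `ℂ` at once -/

section Field

variable {𝕜 : Type*} [NontriviallyNormedField 𝕜] [NormedAlgebra 𝕜 ℂ]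

theorem affineChart_mdifferentiableAt {e : OpenPartialHomeomorph CP2 (ℂ × ℂ)}
    (he : e ∈ atlas (ℂ × ℂ) CP2) {p : CP2} (hp : p ∈ e.source) :
    MDifferentiableAt 𝓘(𝕜, ℂ × ℂ) 𝓘(𝕜, ℂ × ℂ) e p :=
  haveI := isManifold_aux 𝕜 1
  mdifferentiableAt_atlas he hp

theorem mfderiv_affineChart_field [IsScalarTower 𝕜 ℂ (ℂ × ℂ)] {i j k : Fin 3}
    (h : i ≠ j ∧ j ≠ k ∧ i ≠ k)
    (he : affineChart i j k h ∈ atlas (ℂ × ℂ) CP2) {p : CP2} (hp : p ∈ affineOpen k) :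
    (mfderiv 𝓘(𝕜, ℂ × ℂ) 𝓘(𝕜, ℂ × ℂ) (affineChart i j k h) p (field p : ℂ × ℂ) : ℂ × ℂ)
      = chartField i j k (affineChart i j k h p) := by
  obtain ⟨L, hL, hLf⟩ := exists_hasFDerivAt_chart h hp
  rw [(affineChart_mdifferentiableAt (𝕜 := 𝕜) he hp).mfderiv]
  simp only [writtenInExtChartAt, mfld_simps, fderivWithin_univ]
  have := (hL.restrictScalars 𝕜).fderiv
  refine Eq.trans ?_ hLf
  exact DFunLike.congr_fun this _

theorem contMDiff_field [IsScalarTower 𝕜 ℂ (ℂ × ℂ)] (n : ℕ∞ω)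
    [IsManifold 𝓘(𝕜, ℂ × ℂ) 1 CP2] [IsManifold 𝓘(𝕜, ℂ × ℂ) n CP2] :
    ContMDiff 𝓘(𝕜, ℂ × ℂ) 𝓘(𝕜, ℂ × ℂ).tangent n
        (fun p => (⟨p, (field p : ℂ × ℂ)⟩ : TangentBundle 𝓘(𝕜, ℂ × ℂ) CP2)) := by
  intro p₀
  refine (Bundle.contMDiffAt_section p₀).2 ?_
  obtain ⟨i, j, k, h, hc⟩ := chartAt_eq p₀
  have he : affineChart i j k h ∈ atlas (ℂ × ℂ) CP2 := hc ▸ chart_mem_atlas _ p₀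
  have hp₀ : p₀ ∈ affineOpen k := by
    have := mem_chart_source (ℂ × ℂ) p₀
    rwa [hc] at this
  have hcomp : ContMDiffAt 𝓘(𝕜, ℂ × ℂ) 𝓘(𝕜, ℂ × ℂ) n
      (fun p => chartField i j k (affineChart i j k h p)) p₀ := by
    refine ContMDiffAt.comp p₀ (g := chartField i j k) ?_ (contMDiffAt_of_mem_maximalAtlas
      (IsManifold.subset_maximalAtlas he) hp₀)
    refine ContMDiff.contMDiffAt (ContDiff.contMDiff ?_)
    have hh (l : Fin 3) : ContDiff 𝕜 n (fun z => homog i k z l) := by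
      unfold homog
      split_ifs <;> fun_prop
    have hl (l : Fin 3) : ContDiff 𝕜 n (fun z => linearField (homog i k z) l) := by
      fin_cases l
      · exact hh 1
      · exact contDiff_const
      · exact (hh 0).neg
    exact ((hl i).sub (contDiff_fst.mul (hl k))).prodMk ((hl j).sub (contDiff_snd.mul (hl k)))
  refine hcomp.congr_of_eventuallyEq ?_
  -- The preferred chart may change near `p₀`; the trivialization at `p₀` applies the derivative of
  -- the coordinate change, which yields the polynomial components in the chart at `p₀`.
  filter_upwards [(isOpen_affineOpen k).mem_nhds hp₀] with p hp
  rw [TangentBundle.trivializationAt_apply, hc]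
  obtain ⟨L, hL, hLf⟩ := exists_hasFDerivAt_chart h hp
  simp only [mfld_simps, fderivWithin_univ]
  refine Eq.trans ?_ hLf
  exact DFunLike.congr_fun (hL.restrictScalars 𝕜).fderiv _

end Field

/-! ### Real coordinates, explicit chart formulas and zeros -/

/-- The real coordinates of `ℂ²`. -/
noncomputable def realCoordsCLM : ℂ × ℂ →L[ℝ] EuclideanSpace ℝ (Fin 4) :=
  LinearMap.toContinuousLinearMap
    { toFun := fun z => !₂[z.1.re, z.1.im, z.2.re, z.2.im]
      map_add' := fun z w => by ext l; fin_cases l <;> simp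
      map_smul' := fun c z => by ext l; fin_cases l <;> simp }

theorem realCoordsCLM_apply (z : ℂ × ℂ) :
    realCoordsCLM z = !₂[z.1.re, z.1.im, z.2.re, z.2.im] := rfl

theorem mfderiv_realCoords {e : OpenPartialHomeomorph CP2 (ℂ × ℂ)}
    (he : e ∈ atlas (ℂ × ℂ) CP2) {p : CP2} (hp : p ∈ e.source) (v : ℂ × ℂ) :
    (mfderiv 𝓘(ℝ, ℂ × ℂ) 𝓘(ℝ, EuclideanSpace ℝ (Fin 4)) (realCoords e) p v :
      EuclideanSpace ℝ (Fin 4)) =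
      realCoordsCLM (mfderiv 𝓘(ℝ, ℂ × ℂ) 𝓘(ℝ, ℂ × ℂ) e p v) := by
  have h1 := (affineChart_mdifferentiableAt (𝕜 := ℝ) he hp).hasMFDerivAt
  have h2 := realCoordsCLM.hasFDerivAt (x := e p) |>.hasMFDerivAt
  have h3 : HasMFDerivAt 𝓘(ℝ, ℂ × ℂ) 𝓘(ℝ, EuclideanSpace ℝ (Fin 4)) (realCoords e) p _ :=
    h2.comp p h1
  rw [h3.mfderiv]
  rfl

theorem chart1_mem_atlas : chart1 ∈ atlas (ℂ × ℂ) CP2 := Or.inl rfl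

theorem chart2_mem_atlas : chart2 ∈ atlas (ℂ × ℂ) CP2 := Or.inr (Or.inl rfl)

theorem chart3_mem_atlas : chart3 ∈ atlas (ℂ × ℂ) CP2 := Or.inr (Or.inr rfl)

theorem chartField_chart1 (z : ℂ × ℂ) : chartField 0 1 2 z = (z.1 ^ 2 + z.2, z.1 * z.2) := by
  ext <;> simp [chartField, linearField, homog] <;> ring

theorem chartField_chart2 (z : ℂ × ℂ) :
    chartField 1 2 0 z = (-z.1 ^ 2, -(1 + z.1 * z.2)) := by
  ext <;> simp [chartField, linearField, homog] <;> ring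

theorem chartField_chart3 (z : ℂ × ℂ) : chartField 0 2 1 z = (1, -z.1) := by
  ext <;> simp [chartField, linearField, homog]

theorem chartField_chart1_eq_zero_iff (z : ℂ × ℂ) : chartField 0 1 2 z = 0 ↔ z = 0 := by
  rw [chartField_chart1, Prod.ext_iff, Prod.ext_iff]
  constructor
  · rintro ⟨ha, hb⟩
    rcases mul_eq_zero.1 hb with h | h
    · exact ⟨h, by simpa [h] using ha⟩
    · exact ⟨by simpa [h] using ha, h⟩
  · rintro ⟨ha, hb⟩
    simp_all

theorem chartField_chart2_ne_zero (z : ℂ × ℂ) : chartField 1 2 0 z ≠ 0 := by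
  rw [chartField_chart2, Ne, Prod.ext_iff]
  rintro ⟨ha, hb⟩
  have : z.1 = 0 := by simpa using ha
  simp [this] at hb

theorem chartField_chart3_ne_zero (z : ℂ × ℂ) : chartField 0 2 1 z ≠ 0 := by
  simp [chartField_chart3, Prod.ext_iff]

theorem origin1_mem_affineOpen : origin1 ∈ affineOpen 2 :=
  chart1.map_target (Set.mem_univ (0, 0))

theorem chart1_origin1 : chart1 origin1 = 0 := chart1.right_inv (Set.mem_univ (0, 0))

theorem field_eq_zero_iff (p : CP2) : field p = 0 ↔ p = origin1 := by
  by_cases h2 : p ∈ affineOpen 2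
  · have hf : (field p : ℂ × ℂ) = chartField 0 1 2 (chart1 p) := if_pos h2
    refine (iff_of_eq (congrArg (· = (0 : ℂ × ℂ)) hf)).trans
      ((chartField_chart1_eq_zero_iff _).trans ?_)
    rw [← chart1_origin1]
    exact chart1.injOn.eq_iff h2 origin1_mem_affineOpen
  refine iff_of_false (fun h => ?_) fun h => h2 (h ▸ origin1_mem_affineOpen)
  by_cases h0 : p ∈ affineOpen 0
  · have hf : (field p : ℂ × ℂ) = chartField 1 2 0 (chart2 p) := (if_neg h2).trans (if_pos h0)
    exact chartField_chart2_ne_zero _ (hf.symm.trans h)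
  · have hf : (field p : ℂ × ℂ) = chartField 0 2 1 (chart3 p) := (if_neg h2).trans (if_neg h0)
    exact chartField_chart3_ne_zero _ (hf.symm.trans h)

section Components

variable (𝕜 : Type*) [NontriviallyNormedField 𝕜] [NormedAlgebra 𝕜 ℂ] [IsScalarTower 𝕜 ℂ (ℂ × ℂ)]

theorem hasComponents_chart1 : HasComponents 𝕜 chart1.source chart1
    (fun p => (field p : ℂ × ℂ)) (fun z => (z.1 ^ 2 + z.2, z.1 * z.2)) := fun _ hp =>
  (mfderiv_affineChart_field _ chart1_mem_atlas hp).trans (chartField_chart1 _)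

theorem hasComponents_chart2 : HasComponents 𝕜 chart2.source chart2
    (fun p => (field p : ℂ × ℂ)) (fun z => (-z.1 ^ 2, -(1 + z.1 * z.2))) := fun _ hp =>
  (mfderiv_affineChart_field _ chart2_mem_atlas hp).trans (chartField_chart2 _)

theorem hasComponents_chart3 : HasComponents 𝕜 chart3.source chart3
    (fun p => (field p : ℂ × ℂ)) (fun z => (1, -z.1)) := fun _ hp =>
  (mfderiv_affineChart_field _ chart3_mem_atlas hp).trans (chartField_chart3 _)

end Components

end CP2

/-! ### Local degree of the quadratic map at the origin -/

/-- The derivative of `(z₁² + z₂, z₁ z₂)`. -/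
noncomputable def quadraticMapDeriv (z : ℂ × ℂ) : ℂ × ℂ →L[ℂ] ℂ × ℂ :=
  ((2 * z.1) • ContinuousLinearMap.fst ℂ ℂ ℂ + ContinuousLinearMap.snd ℂ ℂ ℂ).prod
    (z.1 • ContinuousLinearMap.snd ℂ ℂ ℂ + z.2 • ContinuousLinearMap.fst ℂ ℂ ℂ)

theorem hasFDerivAt_quadraticMap (z : ℂ × ℂ) :
    HasFDerivAt (fun z : ℂ × ℂ => (z.1 ^ 2 + z.2, z.1 * z.2)) (quadraticMapDeriv z) z := by
  have h1 : HasFDerivAt (Prod.fst : ℂ × ℂ → ℂ) _ z := hasFDerivAt_fst (𝕜 := ℂ)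
  have h2 : HasFDerivAt (Prod.snd : ℂ × ℂ → ℂ) _ z := hasFDerivAt_snd (𝕜 := ℂ)
  refine (((h1.pow 2).add h2).prodMk (h1.mul h2)).congr_fderiv ?_
  simp [quadraticMapDeriv]

theorem det_quadraticMapDeriv (z : ℂ × ℂ) :
    (quadraticMapDeriv z).det = 2 * z.1 ^ 2 - z.2 := by
  rw [ContinuousLinearMap.det, ← LinearMap.det_toMatrix (Module.Basis.finTwoProd ℂ),
    Matrix.det_fin_two]
  simp [LinearMap.toMatrix_apply, quadraticMapDeriv]
  ring

theorem hasLocalDegreeAt_quadraticMap :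
    HasLocalDegreeAt (fun z : ℂ × ℂ => (z.1 ^ 2 + z.2, z.1 * z.2)) 0 3 where
  contDiffAt := by fun_prop
  map_eq_zero := by simp
  isolated := by
    filter_upwards [self_mem_nhdsWithin] with z hz h0
    rw [← CP2.chartField_chart1, CP2.chartField_chart1_eq_zero_iff] at h0
    exact hz h0
  count := by
    filter_upwards [self_mem_nhdsWithin] with r hr
    replace hr : 0 < r := hr
    -- With `δ ≤ 1`, the single bound `‖y‖ < δ ^ 3 / 2` controls both coefficients of the cubic. A
    -- solution then has `‖z.1‖ < δ` and `‖z.2‖ < 2 * δ ≤ r`, so every solution in `ℂ²` lies in the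
    -- ball.
    obtain ⟨δ, hδ, hδ1, hδr⟩ : ∃ δ : ℝ, 0 < δ ∧ δ ≤ 1 ∧ 2 * δ ≤ r :=
      ⟨min 1 (r / 2), by positivity, min_le_left _ _, by linarith [min_le_right 1 (r / 2)]⟩
    have hε : 0 < δ ^ 3 / 2 := by positivity
    have h32 : δ ^ 3 ≤ δ ^ 2 := pow_le_pow_of_le_one hδ.le hδ1 (by norm_num)
    have h21 : δ ^ 2 ≤ δ := by nlinarith
    filter_upwards [Metric.ball_mem_nhds 0 hε] with y hy hreg
    rw [mem_ball_zero_iff, Prod.norm_def, max_lt_iff] at hy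
    have hiff (z : ℂ × ℂ) : (z.1 ^ 2 + z.2, z.1 * z.2) = y ↔
        z.1 ^ 3 - y.1 * z.1 + y.2 = 0 ∧ z.2 = y.1 - z.1 ^ 2 := by
      rw [Prod.ext_iff]
      constructor
      · rintro ⟨h1, h2⟩
        exact ⟨by rw [← h1, ← h2]; ring, by rw [← h1]; ring⟩
      · rintro ⟨h1, h2⟩
        exact ⟨by rw [h2]; ring, by rw [h2]; linear_combination -h1⟩
    have hball (z : ℂ × ℂ) (hz : (z.1 ^ 2 + z.2, z.1 * z.2) = y) : z ∈ Metric.ball 0 r := by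
      obtain ⟨h1, h2⟩ := (hiff z).1 hz
      have hz1 : ‖z.1‖ < δ := norm_lt_of_cubic_eq_zero hδ (by linarith) hy.2 h1
      have hz2 : ‖z.2‖ < 2 * δ := by
        have : ‖z.1‖ ^ 2 ≤ δ ^ 2 := by gcongr
        calc ‖z.2‖ ≤ ‖y.1‖ + ‖z.1‖ ^ 2 := by
              rw [h2, ← norm_pow]
              exact norm_sub_le _ _
          _ < 2 * δ := by linarith
      rw [mem_ball_zero_iff, Prod.norm_def, max_lt_iff]
      constructor <;> linarith
    have hdet (z : ℂ × ℂ) :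
        (fderiv ℝ (fun z : ℂ × ℂ => (z.1 ^ 2 + z.2, z.1 * z.2)) z).det =
          Complex.normSq (2 * z.1 ^ 2 - z.2) := by
      rw [((hasFDerivAt_quadraticMap z).restrictScalars ℝ).fderiv,
        det_restrictScalars_eq_normSq, det_quadraticMapDeriv]
    -- On the fibre `z.2 = y.1 - z.1 ^ 2`, the complex Jacobian `2 * z.1 ^ 2 - z.2` is the
    -- derivative of the cubic, so regularity of `y` means simple roots.
    obtain ⟨s, hs3, hs⟩ := exists_finset_roots_cubic y.1 y.2 fun z hz h0 => by
      have hpre := (hiff (z, y.1 - z ^ 2)).2 ⟨hz, rfl⟩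
      refine hreg _ (hball _ hpre) hpre ?_
      rw [hdet]
      have : 2 * z ^ 2 - (y.1 - z ^ 2) = 0 := by linear_combination h0
      simp [this]
    have hset : {u ∈ Metric.ball (0 : ℂ × ℂ) r | (u.1 ^ 2 + u.2, u.1 * u.2) = y} =
        (s.image fun z => (z, y.1 - z ^ 2) : Finset (ℂ × ℂ)) := by
      ext u
      simp only [Set.mem_ofPred_eq, Finset.coe_image, Set.mem_image, Finset.mem_coe, hs]
      constructor
      · rintro ⟨-, hu⟩
        obtain ⟨h1, h2⟩ := (hiff u).1 hu
        exact ⟨u.1, h1, Prod.ext rfl h2.symm⟩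
      · rintro ⟨z, hz, rfl⟩
        have hpre := (hiff (z, y.1 - z ^ 2)).2 ⟨hz, rfl⟩
        exact ⟨hball _ hpre, hpre⟩
    have hsign : ∀ u ∈ {u ∈ Metric.ball (0 : ℂ × ℂ) r | (u.1 ^ 2 + u.2, u.1 * u.2) = y},
        (SignType.sign (fderiv ℝ (fun z : ℂ × ℂ => (z.1 ^ 2 + z.2, z.1 * z.2)) u).det : ℤ)
          = 1 := by
      rintro u ⟨hu, hpre⟩
      have hne := hreg u hu hpre
      rw [hdet] at hne ⊢
      rw [sign_pos (lt_of_le_of_ne (Complex.normSq_nonneg _) hne.symm)]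
      rfl
    refine ⟨by rw [hset]; exact Finset.finite_toSet _, ?_⟩
    refine (finsum_mem_congr rfl hsign).trans ?_
    rw [hset, finsum_mem_coe_finset, Finset.sum_const,
      Finset.card_image_of_injective _ fun a b hab => congrArg Prod.fst hab, hs3]
    rfl

theorem mainTheorem3 :
    ∃ V : (p : CP2) → TangentSpace 𝓘(ℂ, ℂ × ℂ) p,
      -- `V` is a holomorphic vector field on all of `CP2`
      ContMDiff 𝓘(ℂ, ℂ × ℂ) 𝓘(ℂ, ℂ × ℂ).tangent ω
        (fun p => (⟨p, V p⟩ : TangentBundle 𝓘(ℂ, ℂ × ℂ) CP2)) ∧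
      -- its components in the three charts
      CP2.HasComponents ℂ CP2.chart1.source CP2.chart1 V
        (fun z => (z.1 ^ 2 + z.2, z.1 * z.2)) ∧
      CP2.HasComponents ℂ CP2.chart2.source CP2.chart2 V
        (fun ζ => (-ζ.1 ^ 2, -(1 + ζ.1 * ζ.2))) ∧
      CP2.HasComponents ℂ CP2.chart3.source CP2.chart3 V
        (fun ξ => (1, -ξ.1)) ∧
      -- its only zero
      (∀ p, V p = 0 ↔ p = CP2.origin1) ∧
      -- the real part is a smooth real vector field
      ContMDiff 𝓘(ℝ, ℂ × ℂ) 𝓘(ℝ, ℂ × ℂ).tangent ∞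
        (fun p => (⟨p, CP2.realPart V p⟩ : TangentBundle 𝓘(ℝ, ℂ × ℂ) CP2)) ∧
      -- its components in the real coordinates `(x, y, z, t)`, `(a, b, c, d)`, `(α, β, γ, δ)`
      CP2.HasComponents ℝ CP2.chart1.source (CP2.realCoords CP2.chart1) (CP2.realPart V)
        (fun x => !₂[x 0 ^ 2 - x 1 ^ 2 + x 2, 2 * x 0 * x 1 + x 3,
          x 0 * x 2 - x 3 * x 1, x 3 * x 0 + x 1 * x 2]) ∧
      CP2.HasComponents ℝ CP2.chart2.source (CP2.realCoords CP2.chart2) (CP2.realPart V)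
        (fun a => !₂[-(a 0 ^ 2 - a 1 ^ 2), -(2 * a 0 * a 1),
          -(a 0 * a 2 - a 1 * a 3 + 1), -(a 0 * a 3 + a 1 * a 2)]) ∧
      CP2.HasComponents ℝ CP2.chart3.source (CP2.realCoords CP2.chart3) (CP2.realPart V)
        (fun α => !₂[1, 0, -α 0, -α 1]) ∧
      -- the only zero of the real part; it is isolated with index `+3`
      (∀ p, CP2.realPart V p = 0 ↔ p = CP2.origin1) ∧
      HasIndexAt (CP2.realPart V) CP2.origin1 3 := by
  refine ⟨CP2.field, CP2.contMDiff_field ω, CP2.hasComponents_chart1 ℂ,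
    CP2.hasComponents_chart2 ℂ, CP2.hasComponents_chart3 ℂ, CP2.field_eq_zero_iff,
    CP2.contMDiff_field ∞, fun p hp => ?_, fun p hp => ?_, fun p hp => ?_,
    CP2.field_eq_zero_iff, ?_⟩
  · refine (CP2.mfderiv_realCoords CP2.chart1_mem_atlas hp _).trans
      ((congrArg CP2.realCoordsCLM (CP2.hasComponents_chart1 ℝ p hp)).trans ?_)
    rw [CP2.realCoordsCLM_apply]
    ext l
    fin_cases l <;> simp [CP2.realCoords, pow_two] <;> ring
  · refine (CP2.mfderiv_realCoords CP2.chart2_mem_atlas hp _).trans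
      ((congrArg CP2.realCoordsCLM (CP2.hasComponents_chart2 ℝ p hp)).trans ?_)
    rw [CP2.realCoordsCLM_apply]
    ext l
    fin_cases l <;> simp [CP2.realCoords, pow_two] <;> ring
  · refine (CP2.mfderiv_realCoords CP2.chart3_mem_atlas hp _).trans
      ((congrArg CP2.realCoordsCLM (CP2.hasComponents_chart3 ℝ p hp)).trans ?_)
    rw [CP2.realCoordsCLM_apply]
    ext l
    fin_cases l <;> simp [CP2.realCoords]
  · have hc : chartAt (ℂ × ℂ) CP2.origin1 = CP2.chart1 := if_pos CP2.origin1_mem_affineOpen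
    rw [HasIndexAt, hc, CP2.chart1_origin1]
    refine (congrArg (HasLocalDegreeAt · (0 : ℂ × ℂ) 3) (funext fun u => ?_)).mpr
      hasLocalDegreeAt_quadraticMap
    refine (CP2.hasComponents_chart1 ℝ _ (CP2.chart1.map_target (Set.mem_univ u))).trans ?_
    have hu : CP2.chart1 (CP2.chart1.symm u) = u := CP2.chart1.right_inv (Set.mem_univ u)
    rw [hu]
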